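/- All subgroups of topological groups are understood to be closed, with the subspace topology. A topological group $G$ is residually finite if the intersection of its (closed) normal subgroups of finite index is trivial; it is just infinite if it is infinite, residually finite, and every non-trivial closed normal subgroup of $G$ has finite index; it is hereditarily just infinite if every closed subgroup of finite index in $G$, including $G$ itself, is just infinite. A profinite group is pronilpotent if it is the inverse limit of an inverse system of finite nilpotent groups, and a topological group is virtually pronilpotent (respectively, virtually abelian) if it has a closed subgroup of finite index that is pronilpotent (respectively, abelian). For a profinite group $G$, the Frattini subgroup $\Phi(G)$ is the intersection of all maximal closed subgroups of $G$, that is, of all maximal elements of the set of proper closed subgroups of $G$. Let $G$ be a just infinite profinite group that is virtually pronilpotent but not virtually abelian. Then $G$ is hereditarily just infinite if and only if $\Phi(G)$ is just infinite. -/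

import Mathlib

universe u

/-- A topological group is residually finite if the intersection of its closed normal subgroups of
finite index is trivial. -/
def TopResiduallyFinite (G : Type*) [Group G] [TopologicalSpace G] : Prop :=
  sInf {N : Subgroup G | IsClosed (N : Set G) ∧ N.Normal ∧ N.FiniteIndex} = ⊥

/-- A topological group is just infinite if it is infinite and residually finite, and every
non-trivial closed normal subgroup has finite index. -/
structure IsJustInfinite (G : Type*) [Group G] [TopologicalSpace G] : Prop where
  infinite : Infinite G
  residuallyFinite : TopResiduallyFinite G
  finiteIndex : ∀ N : Subgroup G, IsClosed (N : Set G) → N.Normal → N ≠ ⊥ → N.FiniteIndex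

/-- A topological group is hereditarily just infinite if all its closed subgroups of finite index
(the whole group included) are just infinite. -/
def IsHereditarilyJustInfinite (G : Type*) [Group G] [TopologicalSpace G] : Prop :=
  ∀ H : Subgroup G, IsClosed (H : Set G) → H.FiniteIndex → IsJustInfinite H

/-- A topological group is virtually abelian if it has an abelian closed subgroup of finite
index. -/
def IsTopVirtuallyAbelian (G : Type*) [Group G] [TopologicalSpace G] : Prop :=
  ∃ H : Subgroup G, IsClosed (H : Set G) ∧ H.FiniteIndex ∧ IsMulCommutative H

/-- A topological group is pronilpotent if it is (topologically isomorphic to) the limit of an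
inverse system of finite nilpotent groups, each with the discrete topology. -/
def IsPronilpotent (G : Type u) [Group G] [TopologicalSpace G] : Prop :=
  ∃ (J : Type u) (_ : Preorder J) (_ : Nonempty J) (_ : IsCodirectedOrder J)
    (F : CategoryTheory.Functor J FiniteGrp.{u}),
    (∀ j, Group.IsNilpotent (F.obj j)) ∧
      Nonempty (G ≃ₜ* ProfiniteGrp.limit
        (F.comp (CategoryTheory.forget₂ FiniteGrp.{u} ProfiniteGrp.{u})))

/-- A topological group is virtually pronilpotent if it has a pronilpotent closed subgroup of finite
index. -/
def IsVirtuallyPronilpotent (G : Type u) [Group G] [TopologicalSpace G] : Prop :=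
  ∃ H : Subgroup G, IsClosed (H : Set G) ∧ H.FiniteIndex ∧ IsPronilpotent H

/-- The Frattini subgroup of a topological group: the intersection of all maximal closed subgroups,
that is, of the maximal elements among the proper closed subgroups. -/
def topFrattini (G : Type*) [Group G] [TopologicalSpace G] : Subgroup G :=
  sInf {M : Subgroup G | Maximal (fun K : Subgroup G => IsClosed (K : Set G) ∧ K ≠ ⊤) M}

/-!
Let `G` be a just infinite profinite group that is not virtually abelian. The fact used throughout
is that a nontrivial subgroup of `G` never has a centralizer of finite index
(`IsJustInfinite.not_finiteIndex_centralizer`). Hence a nontrivial subgroup whose normalizer has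
finite index meets every normal subgroup of finite index nontrivially (`IsJustInfinite.inf_ne_bot`).

Suppose that the Frattini subgroup `Φ` is just infinite, but that some closed subgroup `H` of
finite index has a closed nontrivial normal subgroup `K` of infinite index. Among the nontrivial
intersections of conjugates of `K ⊓ H.normalCore`, a minimal one, `B`, commutes with each of its
conjugates other than itself (`Subgroup.exists_le_forall_conj_smul_commute`). It is not normal in
`G`, since it has infinite index, so its normalizer lies in a maximal closed subgroup `M`. The
elements of `Φ` centralizing all `gBg⁻¹` with `g ∉ M` form a closed subgroup, normal in `Φ` since
`Φ ≤ M`. It contains `B ⊓ Φ`, hence is nontrivial, and it has infinite index because it centralizes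
some conjugate of `B`. This is a contradiction
(`IsJustInfinite.not_isJustInfinite_of_conj_smul_commute`).

Conversely, if `G` is hereditarily just infinite, it suffices that `Φ` is nontrivial, for then it
has finite index. The core `F` of a closed pronilpotent subgroup of finite index satisfies
`⁅F, F⁆ ≤ Φ` (`commutator_le_topFrattini`): in a pronilpotent group, commutators can be omitted from
topological generating sets. If `Φ` were trivial, then `F` would be abelian.
-/

/-! ### Just infinite groups that are not virtually abelian -/

open scoped Pointwise

/-- If `centralizer K` had finite index, its core and the centralizer of this core would both be
closed normal subgroups of finite index, and their intersection is abelian. -/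
theorem IsJustInfinite.not_finiteIndex_centralizer {G : Type*} [Group G] [TopologicalSpace G]
    [IsTopologicalGroup G] [T2Space G] (hG : IsJustInfinite G) (hab : ¬ IsTopVirtuallyAbelian G)
    {K : Subgroup G} (hK : K ≠ ⊥) : ¬ (Subgroup.centralizer (K : Set G)).FiniteIndex := by
  intro h
  set C := (Subgroup.centralizer (K : Set G)).normalCore with hC
  have hCcl : IsClosed (C : Set G) :=
    Subgroup.normalCore_isClosed _ (Set.isClosed_centralizer (K : Set G))
  have hKC : K ≤ Subgroup.centralizer (C : Set G) :=
    Subgroup.le_centralizer_iff.mpr (Subgroup.normalCore_le _)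
  have hZ : (Subgroup.centralizer (C : Set G)).FiniteIndex :=
    hG.finiteIndex _ (Set.isClosed_centralizer (C : Set G)) inferInstance
      (fun hbot => hK (le_bot_iff.mp (hbot ▸ hKC)))
  refine hab ⟨C ⊓ Subgroup.centralizer (C : Set G),
    hCcl.inter (Set.isClosed_centralizer (C : Set G)), inferInstance, ?_⟩
  rw [← Subgroup.le_centralizer_iff_isMulCommutative]
  exact inf_le_right.trans (Subgroup.centralizer_le inf_le_left)

/-- If `B ⊓ N` were trivial, then `N ⊓ D` would centralize `B`. -/
theorem IsJustInfinite.inf_ne_bot {G : Type*} [Group G] [TopologicalSpace G]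
    [IsTopologicalGroup G] [T2Space G] (hG : IsJustInfinite G) (hab : ¬ IsTopVirtuallyAbelian G)
    {B D N : Subgroup G} (hB : B ≠ ⊥) [D.FiniteIndex] (hD : D ≤ Subgroup.normalizer (B : Set G))
    [N.Normal] [N.FiniteIndex] : B ⊓ N ≠ ⊥ := by
  intro h
  refine hG.not_finiteIndex_centralizer hab hB
    (Subgroup.finiteIndex_of_le (H := N ⊓ D) ?_)
  rw [← Subgroup.commutator_eq_bot_iff_le_centralizer, ← le_bot_iff, ← h]
  refine le_inf ?_ ((Subgroup.commutator_mono inf_le_left le_rfl).trans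
    (Subgroup.commutator_le_left _ _))
  exact Subgroup.le_normalizer_iff_commutator_le_right.mp (inf_le_right.trans hD)

theorem Subgroup.mem_conj_smul_iff {G : Type*} [Group G] {B : Subgroup G} {g x : G} :
    x ∈ MulAut.conj g • B ↔ g⁻¹ * x * g ∈ B := by
  rw [Subgroup.mem_pointwise_smul_iff_inv_smul_mem, ← map_inv, MulAut.smul_def,
    MulAut.conj_apply, inv_inv]

theorem Subgroup.mem_normalizer_iff_conj_smul_eq {G : Type*} [Group G] {B : Subgroup G} {g : G} :
    g ∈ Subgroup.normalizer (B : Set G) ↔ MulAut.conj g • B = B :=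
  Subgroup.mem_normalizer_iff_map_conj_eq

theorem Subgroup.finite_range_conj_smul {G : Type*} [Group G] {B C : Subgroup G} [C.FiniteIndex]
    (hC : C ≤ Subgroup.normalizer (B : Set G)) :
    (Set.range fun g : G => MulAut.conj g • B).Finite := by
  refine (Set.finite_range fun q : G ⧸ C => MulAut.conj q.out • B).subset ?_
  rintro _ ⟨g, rfl⟩
  refine ⟨(g : G ⧸ C), ?_⟩
  obtain ⟨c, hc⟩ := QuotientGroup.mk_out_eq_mul C g
  simp only [hc, map_mul, mul_smul]
  rw [Subgroup.mem_normalizer_iff_conj_smul_eq.mp (hC c.2)]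

theorem Subgroup.isClosed_conj_smul {G : Type*} [Group G] [TopologicalSpace G]
    [IsTopologicalGroup G] {B : Subgroup G} (hB : IsClosed (B : Set G)) (g : G) :
    IsClosed ((MulAut.conj g • B : Subgroup G) : Set G) := by
  have : ((MulAut.conj g • B : Subgroup G) : Set G) = (fun x => g⁻¹ * x * g) ⁻¹' B := by
    ext x
    exact Subgroup.mem_conj_smul_iff
  rw [this]
  exact hB.preimage (by fun_prop)

theorem Subgroup.conj_smul_sInf {G : Type*} [Group G] (S : Set (Subgroup G)) (g : G) :
    MulAut.conj g • sInf S = sInf ((fun L => MulAut.conj g • L) '' S) := by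
  ext x
  simp only [Subgroup.mem_conj_smul_iff, Subgroup.mem_sInf, Set.forall_mem_image]

/-- A subgroup `K` with finitely many conjugates, normal in a normal subgroup `C`, contains a
nontrivial subgroup commuting with each of its conjugates other than itself: take a minimal
nontrivial intersection of conjugates of `K`. -/
theorem Subgroup.exists_le_forall_conj_smul_commute {G : Type*} [Group G] [TopologicalSpace G]
    [IsTopologicalGroup G] {K C : Subgroup G} [C.Normal] [C.FiniteIndex]
    (hKcl : IsClosed (K : Set G)) (hK : K ≠ ⊥) (hKC : K ≤ C)
    (hCK : C ≤ Subgroup.normalizer (K : Set G)) :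
    ∃ B ≤ K, IsClosed (B : Set G) ∧ B ≠ ⊥ ∧ C ≤ Subgroup.normalizer (B : Set G) ∧
      ∀ g : G, MulAut.conj g • B ≠ B →
        B ≤ Subgroup.centralizer (MulAut.conj g • B : Subgroup G) := by
  set O := Set.range fun g : G => MulAut.conj g • K
  have hOfin : O.Finite := Subgroup.finite_range_conj_smul hCK
  set X : Set (Subgroup G) := {L | L ≠ ⊥ ∧ ∃ S ⊆ O, S.Nonempty ∧ sInf S = L}
  have hXfin : X.Finite := by
    refine (hOfin.finite_subsets.image sInf).subset ?_
    rintro _ ⟨-, S, hS, -, rfl⟩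
    exact ⟨S, hS, rfl⟩
  have hKX : K ∈ X := ⟨hK, {K}, by rintro _ rfl; exact ⟨1, by simp⟩, by simp, by simp⟩
  obtain ⟨B, hBK, hBmin⟩ := hXfin.exists_le_minimal hKX
  obtain ⟨hB, S, hSO, hSne, hSB⟩ := hBmin.prop
  have hCO : ∀ L ∈ O, C ≤ Subgroup.normalizer (L : Set G) := by
    rintro _ ⟨g, rfl⟩ c hc
    have hc' : g⁻¹ * c * g ∈ C := by
      simpa using (inferInstance : C.Normal).conj_mem c hc g⁻¹
    have h := Subgroup.mem_normalizer_iff_conj_smul_eq.mp (hCK hc')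
    have hcg : MulAut.conj c • MulAut.conj g • K =
        MulAut.conj g • MulAut.conj (g⁻¹ * c * g) • K := by
      rw [← mul_smul, ← mul_smul, ← map_mul, ← map_mul]
      group
    rw [Subgroup.mem_normalizer_iff_conj_smul_eq]
    exact hcg.trans (by rw [h])
  have hgX : ∀ g : G, ∀ L ∈ X, MulAut.conj g • L ∈ X := by
    rintro g _ ⟨hL, T, hT, hTne, rfl⟩
    refine ⟨fun h => hL ?_, (fun L => MulAut.conj g • L) '' T, ?_, hTne.image _,
      (Subgroup.conj_smul_sInf T g).symm⟩
    · rw [← inv_smul_smul (MulAut.conj g) (sInf T), h, Subgroup.smul_bot]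
    · rintro _ ⟨L, hL, rfl⟩
      obtain ⟨k, rfl⟩ := hT hL
      exact ⟨g * k, by simp [mul_smul]⟩
  have hXnorm : ∀ L ∈ X, C ≤ Subgroup.normalizer (L : Set G) := by
    rintro _ ⟨-, T, hT, -, rfl⟩
    rw [Subgroup.le_normalizer_iff]
    intro c hc x hx
    rw [Subgroup.mem_sInf] at hx ⊢
    exact fun L hL => Subgroup.le_normalizer_iff.mp (hCO L (hT hL)) c hc x (hx L hL)
  refine ⟨B, hBK, ?_, hB, hXnorm B hBmin.prop, fun g hg => ?_⟩
  · rw [← hSB, Subgroup.coe_sInf]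
    refine isClosed_biInter fun L hL => ?_
    obtain ⟨k, rfl⟩ := hSO hL
    exact Subgroup.isClosed_conj_smul hKcl k
  -- minimality of `B` shows that distinct conjugates of `B` meet trivially
  have hle : ∀ k : G, B ⊓ MulAut.conj k • B ≠ ⊥ → B ≤ MulAut.conj k • B := by
    intro k hk
    obtain ⟨-, T, hT, hTne, hTB⟩ := hgX k B hBmin.prop
    have : B ⊓ MulAut.conj k • B ∈ X :=
      ⟨hk, S ∪ T, Set.union_subset hSO hT, hSne.inl, by rw [sInf_union, hSB, hTB]⟩
    exact (hBmin.le_of_le this inf_le_left).trans inf_le_right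
  have hinf : B ⊓ MulAut.conj g • B = ⊥ := by
    by_contra h
    refine hg (le_antisymm ?_ (hle g h))
    have h' : B ⊓ MulAut.conj g⁻¹ • B ≠ ⊥ := by
      intro h0
      apply h
      rw [← Subgroup.smul_bot (MulAut.conj g), ← h0, Subgroup.smul_inf, ← mul_smul, ← map_mul,
        mul_inv_cancel, map_one, one_smul, inf_comm]
    rw [Subgroup.pointwise_smul_subset_iff, ← map_inv]
    exact hle _ h'
  have hBC : B ≤ C := hBK.trans hKC
  have hgBC : MulAut.conj g • B ≤ C := by
    rw [← Subgroup.Normal.conj_smul_eq_self g C]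
    exact Subgroup.pointwise_smul_le_pointwise_smul_iff.mpr hBC
  rw [← Subgroup.commutator_eq_bot_iff_le_centralizer, ← le_bot_iff, ← hinf]
  exact le_inf
    (Subgroup.le_normalizer_iff_commutator_le_left.mp (hgBC.trans (hXnorm B hBmin.prop)))
    (Subgroup.le_normalizer_iff_commutator_le_right.mp
      (hBC.trans (hXnorm _ (hgX g B hBmin.prop))))

/-! ### The Frattini subgroup -/

theorem isClosed_topFrattini (G : Type*) [Group G] [TopologicalSpace G] :
    IsClosed (topFrattini G : Set G) := by
  rw [topFrattini, Subgroup.coe_sInf]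
  refine isClosed_biInter fun M hM => ?_
  change Maximal (fun K : Subgroup G => IsClosed (K : Set G) ∧ K ≠ ⊤) M at hM
  exact hM.prop.1

theorem topFrattini_le {G : Type*} [Group G] [TopologicalSpace G] {M : Subgroup G}
    (hM : Maximal (fun K : Subgroup G => IsClosed (K : Set G) ∧ K ≠ ⊤) M) : topFrattini G ≤ M :=
  sInf_le hM

theorem maximal_conj_smul {G : Type*} [Group G] [TopologicalSpace G] [IsTopologicalGroup G]
    {M : Subgroup G} (hM : Maximal (fun K : Subgroup G => IsClosed (K : Set G) ∧ K ≠ ⊤) M)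
    (g : G) :
    Maximal (fun K : Subgroup G => IsClosed (K : Set G) ∧ K ≠ ⊤) (MulAut.conj g • M) := by
  have hne : ∀ (k : G) (L : Subgroup G), L ≠ ⊤ → MulAut.conj k • L ≠ ⊤ := by
    intro k L hL h
    apply hL
    rw [← inv_smul_smul (MulAut.conj k) L, h, ← map_inv, Subgroup.Normal.conj_smul_eq_self]
  refine ⟨⟨Subgroup.isClosed_conj_smul hM.prop.1 g, hne g M hM.prop.2⟩, fun L hL hML => ?_⟩
  rw [Subgroup.pointwise_smul_subset_iff, ← map_inv] at hML
  have := hM.le_of_ge ⟨Subgroup.isClosed_conj_smul hL.1 _, hne _ L hL.2⟩ hML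
  rwa [map_inv, ← Subgroup.subset_pointwise_smul_iff] at this

instance topFrattini_normal (G : Type*) [Group G] [TopologicalSpace G] [IsTopologicalGroup G] :
    (topFrattini G).Normal where
  conj_mem x hx g := by
    rw [topFrattini, Subgroup.mem_sInf] at hx ⊢
    intro M hM
    have := hx _ (maximal_conj_smul hM g⁻¹)
    rwa [Subgroup.mem_conj_smul_iff, inv_inv] at this

theorem exists_ge_maximal_isClosed {G : Type*} [Group G] [TopologicalSpace G]
    [IsTopologicalGroup G] {C L : Subgroup G} (hC : IsClosed (C : Set G)) [C.FiniteIndex]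
    (hCL : C ≤ L) (hL : L ≠ ⊤) :
    ∃ M, L ≤ M ∧ Maximal (fun K : Subgroup G => IsClosed (K : Set G) ∧ K ≠ ⊤) M := by
  have hcl : ∀ K : Subgroup G, L ≤ K → IsClosed (K : Set G) := fun K hK =>
    Subgroup.isClosed_of_isOpen _ (Subgroup.isOpen_mono (hCL.trans hK)
      (Subgroup.isOpen_of_isClosed_of_finiteIndex C hC))
  -- a proper subgroup above `L` of least index is maximal
  obtain ⟨M, ⟨hLM, hM⟩, hmin⟩ := exists_minimalFor_of_wellFoundedLT
    (fun K : Subgroup G => L ≤ K ∧ K ≠ ⊤) Subgroup.index ⟨L, le_rfl, hL⟩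
  refine ⟨M, hLM, ⟨hcl M hLM, hM⟩, fun K hK hMK => ?_⟩
  by_contra hKM
  have : M.FiniteIndex := Subgroup.finiteIndex_of_le (hCL.trans hLM)
  have hlt := Subgroup.index_strictAnti (lt_of_le_not_ge hMK hKM)
  exact hlt.not_ge (hmin ⟨hLM.trans hMK, hK.2⟩ hlt.le)

/-! ### From the Frattini subgroup to all closed subgroups of finite index -/

theorem TopResiduallyFinite.subgroup {G : Type*} [Group G] [TopologicalSpace G]
    (hG : TopResiduallyFinite G) (H : Subgroup G) : TopResiduallyFinite H := by
  rw [TopResiduallyFinite, eq_bot_iff] at *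
  intro x hx
  rw [Subgroup.mem_sInf] at hx
  rw [Subgroup.mem_bot]
  refine Subtype.ext (Subgroup.mem_bot.mp (hG (Subgroup.mem_sInf.mpr ?_)))
  rintro N ⟨hNcl, hN, hNfi⟩
  exact hx (N.subgroupOf H) ⟨hNcl.preimage continuous_subtype_val, inferInstance, inferInstance⟩

/-- The elements of `N` that centralize every conjugate `gBg⁻¹` with `g ∉ M` form a closed normal
subgroup of `N`. It contains `B ⊓ N`, hence is nontrivial, and it has infinite index since it
centralizes at least one conjugate of `B`. -/
theorem IsJustInfinite.not_isJustInfinite_of_conj_smul_commute {G : Type*} [Group G]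
    [TopologicalSpace G] [IsTopologicalGroup G] [T2Space G] (hG : IsJustInfinite G)
    (hab : ¬ IsTopVirtuallyAbelian G) {B C M N : Subgroup G} (hB : B ≠ ⊥) [C.FiniteIndex]
    (hCB : C ≤ Subgroup.normalizer (B : Set G)) (hBM : Subgroup.normalizer (B : Set G) ≤ M)
    (hM : M ≠ ⊤) [N.Normal] [N.FiniteIndex] (hNM : N ≤ M)
    (hcomm : ∀ g : G, MulAut.conj g • B ≠ B →
      B ≤ Subgroup.centralizer (MulAut.conj g • B : Subgroup G)) :
    ¬ IsJustInfinite N := by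
  intro hN
  set Y : Set G := ⋃ g ∈ (M : Set G)ᶜ, ((MulAut.conj g • B : Subgroup G) : Set G) with hY
  set A := Subgroup.centralizer Y with hA
  have hBA : B ≤ A := by
    intro b hb
    rw [hA, Subgroup.mem_centralizer_iff]
    intro y hy
    simp only [hY, Set.mem_iUnion] at hy
    obtain ⟨g, hg, hy⟩ := hy
    exact Subgroup.mem_centralizer_iff.mp (hcomm g (fun h => hg (hBM
      (Subgroup.mem_normalizer_iff_conj_smul_eq.mpr h))) hb) y hy
  have hAnormal : (A.subgroupOf N).Normal := by
    refine ⟨fun a ha n => ?_⟩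
    rw [Subgroup.mem_subgroupOf, hA, Subgroup.mem_centralizer_iff] at ha ⊢
    intro y hy
    have hy' : (n : G)⁻¹ * y * n ∈ Y := by
      simp only [hY, Set.mem_iUnion] at hy ⊢
      obtain ⟨g, hg, hy⟩ := hy
      refine ⟨(n : G)⁻¹ * g, fun h => hg ?_, ?_⟩
      · simpa using mul_mem (hNM n.2) h
      · rw [SetLike.mem_coe, Subgroup.mem_conj_smul_iff] at hy ⊢
        convert hy using 1
        group
    have := congrArg (fun z => (n : G) * z * (n : G)⁻¹) (ha _ hy')
    simp only [Subgroup.coe_mul, Subgroup.coe_inv]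
    convert this using 1 <;> group
  have hAne : A.subgroupOf N ≠ ⊥ := by
    intro h
    rw [Subgroup.subgroupOf_eq_bot] at h
    exact hG.inf_ne_bot hab hB (D := C) hCB (N := N) (h.mono_left hBA).eq_bot
  have hAfi := hN.finiteIndex _ ((Set.isClosed_centralizer Y).preimage continuous_subtype_val)
    hAnormal hAne
  have hAfi' : (A ⊓ N).FiniteIndex := by
    refine ⟨fun h => ?_⟩
    have := Subgroup.relIndex_mul_index (inf_le_right : A ⊓ N ≤ N)
    rw [h, Subgroup.inf_relIndex_right] at this
    exact mul_ne_zero hAfi.index_ne_zero Subgroup.FiniteIndex.index_ne_zero this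
  obtain ⟨g, hg⟩ : ∃ g, g ∉ M := by
    by_contra! h
    exact hM (Subgroup.eq_top_iff' M |>.mpr h)
  refine hG.not_finiteIndex_centralizer hab (K := MulAut.conj g • B) ?_
    (Subgroup.finiteIndex_of_le (H := A ⊓ N) (inf_le_left.trans (Subgroup.centralizer_le ?_)))
  · intro h
    apply hB
    rw [← inv_smul_smul (MulAut.conj g) B, h, Subgroup.smul_bot]
  · exact Set.subset_biUnion_of_mem (u := fun g => ((MulAut.conj g • B : Subgroup G) : Set G)) hg

theorem IsJustInfinite.isHereditarilyJustInfinite {G : Type*} [Group G]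
    [TopologicalSpace G] [IsTopologicalGroup G] [T2Space G] (hG : IsJustInfinite G)
    (hab : ¬ IsTopVirtuallyAbelian G) (hΦ : IsJustInfinite (topFrattini G)) :
    IsHereditarilyJustInfinite G := by
  have : Infinite G := hG.infinite
  intro H hHcl hHfi
  refine ⟨?_, hG.residuallyFinite.subgroup H, fun K hKcl hKn hK => ?_⟩
  · by_contra h
    rw [not_infinite_iff_finite] at h
    have hcard := H.card_mul_index
    rw [Nat.card_eq_zero_of_infinite (α := G)] at hcard
    exact mul_ne_zero Nat.card_pos.ne' hHfi.index_ne_zero hcard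
  by_contra hKfi
  set L := K.map H.subtype with hL
  have hLH : L ≤ H := Subgroup.map_subtype_le K
  have hLcl : IsClosed (L : Set G) := hHcl.isClosedEmbedding_subtypeVal.isClosedMap _ hKcl
  have hLne : L ≠ ⊥ := fun h => hK ((Subgroup.map_eq_bot_iff_of_injective K
    H.subtype_injective).mp h)
  have hLfi : ¬ L.FiniteIndex := fun h => hKfi <| by
    have : (L.subgroupOf H).FiniteIndex := inferInstance
    rwa [hL, Subgroup.subgroupOf, Subgroup.comap_map_eq_self_of_injective H.subtype_injective]
      at this
  have hHL : H ≤ Subgroup.normalizer (L : Set G) := by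
    rw [Subgroup.le_normalizer_iff]
    rintro h hh _ ⟨k, hk, rfl⟩
    exact ⟨⟨h, hh⟩ * k * ⟨h, hh⟩⁻¹, hKn.conj_mem k hk _, rfl⟩
  have hCL := H.normalCore_le.trans hHL
  have hCcl := Subgroup.normalCore_isClosed H hHcl
  obtain ⟨B, hBL, hBcl, hB, hCB, hcomm⟩ := Subgroup.exists_le_forall_conj_smul_commute
    (K := L ⊓ H.normalCore) (C := H.normalCore) (hLcl.inter hCcl)
    (hG.inf_ne_bot hab hLne hHL) inf_le_right
    (by
      rw [Subgroup.le_normalizer_iff]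
      exact fun c hc x hx => ⟨Subgroup.le_normalizer_iff.mp hCL c hc x hx.1,
        H.normalCore_normal.conj_mem x hx.2 c⟩)
  -- `B` is not normal, as it is closed, nontrivial and of infinite index
  have hNB : Subgroup.normalizer (B : Set G) ≠ ⊤ := fun h => by
    have := hG.finiteIndex B hBcl (Subgroup.normalizer_eq_top_iff.mp h) hB
    exact hLfi (Subgroup.finiteIndex_of_le (hBL.trans inf_le_left))
  obtain ⟨M, hBM, hM⟩ := exists_ge_maximal_isClosed hCcl hCB hNB
  have hΦne : topFrattini G ≠ ⊥ := fun h => by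
    have := hΦ.infinite
    rw [h] at this
    exact not_finite (⊥ : Subgroup G)
  have : (topFrattini G).FiniteIndex :=
    hG.finiteIndex _ (isClosed_topFrattini G) inferInstance hΦne
  exact hG.not_isJustInfinite_of_conj_smul_commute hab hB hCB hBM hM.prop.2 (topFrattini_le hM)
    hcomm hΦ

/-! ### Nilpotent and pronilpotent groups -/

theorem Group.IsNilpotent.commutator_le_of_isCoatom {Q : Type*} [Group Q] [Group.IsNilpotent Q]
    {M : Subgroup Q} (hM : IsCoatom M) : commutator Q ≤ M := by
  have := Subgroup.NormalizerCondition.normal_of_coatom M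
    (Group.normalizerCondition_of_isNilpotent (G := Q)) hM
  by_contra h
  -- otherwise `Q ⧸ M` is a nontrivial perfect solvable group
  have hsup : M ⊔ commutator Q = ⊤ := hM.2 _ (left_lt_sup.mpr h)
  have : Nontrivial (Q ⧸ M) := QuotientGroup.nontrivial_iff.mpr hM.1
  refine (Group.IsSolvable.commutator_lt_top_of_nontrivial (Q ⧸ M)).ne ?_
  have hmap := congrArg (Subgroup.map (QuotientGroup.mk' M)) hsup
  rw [Subgroup.map_sup, QuotientGroup.map_mk'_self, bot_sup_eq, commutator_def,
    Subgroup.map_commutator, ← MonoidHom.range_eq_map, QuotientGroup.range_mk'] at hmap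
  exact hmap

theorem Group.IsNilpotent.eq_top_of_sup_commutator_eq_top {Q : Type*} [Group Q] [Finite Q]
    [Group.IsNilpotent Q] {K : Subgroup Q} (h : K ⊔ commutator Q = ⊤) : K = ⊤ := by
  rcases eq_top_or_exists_le_coatom K with hK | ⟨M, hM, hKM⟩
  · exact hK
  · exact absurd (top_le_iff.mp (h ▸ sup_le hKM (commutator_le_of_isCoatom hM))) hM.1

theorem Group.IsNilpotent.le_of_le_sup_commutator {Q : Type*} [Group Q] [Finite Q]
    [Group.IsNilpotent Q] {A K : Subgroup Q} (hKA : K ≤ A) (h : A ≤ K ⊔ ⁅A, A⁆) : A ≤ K := by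
  rw [← Subgroup.subgroupOf_eq_top]
  apply Group.IsNilpotent.eq_top_of_sup_commutator_eq_top
  apply Subgroup.map_injective A.subtype_injective
  rw [Subgroup.map_sup, Subgroup.map_subtype_commutator, Subgroup.map_subgroupOf_eq_of_le hKA,
    ← MonoidHom.range_eq_map, Subgroup.range_subtype]
  exact le_antisymm (sup_le hKA (Subgroup.commutator_le.mpr
    fun a ha b hb => A.mul_mem (A.mul_mem (A.mul_mem ha hb) (A.inv_mem ha)) (A.inv_mem hb))) h

/-- A pronilpotent group has a directed family of open normal subgroups with trivial intersection,
given as the kernels of homomorphisms `π j` to finite nilpotent groups. No topology is put on these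
finite groups: continuity of `π j` for the discrete topology says that preimages are closed. -/
theorem IsPronilpotent.exists_family {P : Type u} [Group P] [TopologicalSpace P]
    (hP : IsPronilpotent P) :
    ∃ (J : Type u) (_ : Nonempty J) (Q : J → Type u) (_ : ∀ j, Group (Q j)) (π : ∀ j, P →* Q j),
      (∀ j, Finite (Q j)) ∧ (∀ j, Group.IsNilpotent (Q j)) ∧
      (∀ j (s : Set (Q j)), IsClosed (π j ⁻¹' s)) ∧
      Directed (· ≥ ·) (fun j => (π j).ker) ∧ ∀ x, (∀ j, π j x = 1) → x = 1 := by
  obtain ⟨J, _, hne, hdir, F, hF, ⟨e⟩⟩ := hP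
  refine ⟨J, hne, fun j => F.obj j, fun j => inferInstance,
    fun j => ((Pi.evalMonoidHom _ j).comp (ProfiniteGrp.limitConePtAux _).subtype).comp
      e.toMulEquiv.toMonoidHom, fun j => inferInstance, hF, ?_, ?_, ?_⟩
  · intro j s
    have hcont : Continuous fun x : P => (e x).val j :=
      (continuous_apply j).comp (continuous_subtype_val.comp e.continuous)
    let Q := (F.comp (CategoryTheory.forget₂ FiniteGrp.{u} ProfiniteGrp.{u})).obj j
    have : DiscreteTopology Q := ⟨rfl⟩
    have hs : IsClosed (X := Q) s := isClosed_discrete (α := Q) s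
    exact hs.preimage hcont
  · intro i j
    obtain ⟨k, hki, hkj⟩ := exists_le_le i j
    have key : ∀ {i : J} (f : k ⟶ i) (x : P), (e x).val k = 1 → (e x).val i = 1 := by
      intro i f x hx
      rw [← (e x).2 f, hx, map_one]
    exact ⟨k, fun x hx => key (CategoryTheory.homOfLE hki) x hx,
      fun x hx => key (CategoryTheory.homOfLE hkj) x hx⟩
  · intro x hx
    apply e.injective
    rw [map_one]
    exact ProfiniteGrp.limit_ext _ _ _ hx

/-- In a pronilpotent group, a closed subgroup `K` of `A` that generates `A` together with the
closure of `⁅A, A⁆` is all of `A`. -/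
theorem IsPronilpotent.le_of_subset_mul_closure_commutator {P : Type u} [Group P]
    [TopologicalSpace P] [IsTopologicalGroup P] [CompactSpace P] (hP : IsPronilpotent P)
    {A K : Subgroup P} (hK : IsClosed (K : Set P)) (hKA : K ≤ A)
    (h : ∀ a ∈ A, ∃ k ∈ K, ∃ c ∈ closure ((⁅A, A⁆ : Subgroup P) : Set P), k * c = a) : A ≤ K := by
  obtain ⟨J, hne, Q, _, π, hfin, hnil, hcl, hdir, hinj⟩ := hP.exists_family
  -- the images of `A` and `K` in each finite nilpotent quotient coincide
  have himage : ∀ j, A.map (π j) ≤ K.map (π j) := by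
    intro j
    have := hnil j
    have := hfin j
    refine Group.IsNilpotent.le_of_le_sup_commutator (Subgroup.map_mono hKA) ?_
    rintro _ ⟨a, ha, rfl⟩
    obtain ⟨k, hk, c, hc, rfl⟩ := h a ha
    have hc' : π j c ∈ (⁅A.map (π j), A.map (π j)⁆ : Subgroup (Q j)) := by
      have hsub : ((⁅A, A⁆ : Subgroup P) : Set P) ⊆
          π j ⁻¹' (⁅A.map (π j), A.map (π j)⁆ : Subgroup (Q j)) := by
        intro x hx
        rw [Set.mem_preimage, ← Subgroup.map_commutator]
        exact ⟨x, hx, rfl⟩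
      exact closure_minimal hsub (hcl j _) hc
    rw [map_mul]
    exact mul_mem (Subgroup.mem_sup_left ⟨k, hk, rfl⟩) (Subgroup.mem_sup_right hc')
  intro a ha
  -- the sets of elements of `K` with the same image as `a` are closed, nonempty and directed
  obtain ⟨k, hk⟩ := IsCompact.nonempty_iInter_of_directed_nonempty_isCompact_isClosed
    (fun j => (K : Set P) ∩ π j ⁻¹' {π j a})
    (fun i j => by
      obtain ⟨l, hi, hj⟩ := hdir i j
      have key : ∀ i, (π l).ker ≤ (π i).ker →
          (K : Set P) ∩ π l ⁻¹' {π l a} ⊆ (K : Set P) ∩ π i ⁻¹' {π i a} := by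
        rintro i hle x ⟨hx, hxa⟩
        refine ⟨hx, ?_⟩
        have : x * a⁻¹ ∈ (π i).ker := hle (by
          rw [MonoidHom.mem_ker, map_mul, map_inv, mul_inv_eq_one]; exact hxa)
        rwa [MonoidHom.mem_ker, map_mul, map_inv, mul_inv_eq_one] at this
      exact ⟨l, key i hi, key j hj⟩)
    (fun j => by
      obtain ⟨k, hk, hka⟩ := himage j ⟨a, ha, rfl⟩
      exact ⟨k, hk, hka⟩)
    (fun j => (hK.inter (hcl j _)).isCompact)
    (fun j => hK.inter (hcl j _))
  rw [Set.mem_iInter] at hk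
  have : k * a⁻¹ = 1 := hinj _ fun j => by
    rw [map_mul, map_inv, mul_inv_eq_one]; exact (hk j).2
  rw [← mul_inv_eq_one.mp this]
  exact (hk hne.some).1

/-! ### From all closed subgroups of finite index to the Frattini subgroup -/

/-- If a maximal closed subgroup `M` did not contain `⁅F, F⁆`, then `M` and the closure of `⁅F, F⁆`
would generate the group, hence `F ⊓ M` and the closure of `⁅F, F⁆` would generate `F`. -/
theorem commutator_le_topFrattini {G : Type u} [Group G] [TopologicalSpace G]
    [IsTopologicalGroup G] [CompactSpace G] [T2Space G] {H F : Subgroup G} (hH : IsClosed (H : Set G))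
    (hP : IsPronilpotent H) (hF : IsClosed (F : Set G)) [F.Normal] (hFH : F ≤ H) :
    ⁅F, F⁆ ≤ topFrattini G := by
  refine le_sInf fun M hM => ?_
  change Maximal (fun K : Subgroup G => IsClosed (K : Set G) ∧ K ≠ ⊤) M at hM
  set N := (⁅F, F⁆ : Subgroup G).topologicalClosure with hN
  have hNn : N.Normal := Subgroup.is_normal_topologicalClosure _
  have hFF : ⁅F, F⁆ ≤ F := Subgroup.commutator_le_left F F
  have hNF : N ≤ F := Subgroup.topologicalClosure_minimal _ hFF hF
  by_contra hcomm
  have htop : M ⊔ N = ⊤ := by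
    by_contra hne
    have hcl : IsClosed ((M ⊔ N : Subgroup G) : Set G) := by
      rw [Subgroup.mul_normal]
      -- a product of two compact sets is compact
      exact (hM.prop.1.isCompact.mul
        (Subgroup.isClosed_topologicalClosure ⁅F, F⁆).isCompact).isClosed
    exact hcomm ((Subgroup.le_topologicalClosure _).trans
      (le_sup_right.trans (hM.le_of_ge ⟨hcl, hne⟩ le_sup_left)))
  have hFM : F ≤ M := by
    have hCompact : CompactSpace H := isCompact_iff_compactSpace.mp hH.isCompact
    have key := hP.le_of_subset_mul_closure_commutator (A := F.subgroupOf H)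
      (K := (F ⊓ M).subgroupOf H) ((hF.inter hM.prop.1).preimage continuous_subtype_val)
      (Subgroup.subgroupOf_mono H inf_le_left) ?_
    · intro x hx
      exact (key (x := ⟨x, hFH hx⟩) hx).2
    rintro ⟨a, haH⟩ ha
    have ha' : a ∈ M ⊔ N := htop ▸ Subgroup.mem_top a
    rw [← SetLike.mem_coe, Subgroup.mul_normal] at ha'
    obtain ⟨m, hm, c, hc, rfl⟩ := ha'
    have hmF : m ∈ F := (Subgroup.mul_mem_cancel_right F (hNF hc)).mp ha
    refine ⟨⟨m, hFH hmF⟩, ⟨hmF, hm⟩, ⟨c, hFH (hNF hc)⟩, ?_, rfl⟩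
    rw [closure_subtype]
    have himage : ((↑) : H → G) '' (⁅F.subgroupOf H, F.subgroupOf H⁆ : Subgroup H) =
        (⁅F, F⁆ : Subgroup G) := by
      change ((Subgroup.map H.subtype ⁅F.subgroupOf H, F.subgroupOf H⁆ : Subgroup G) : Set G) = _
      rw [Subgroup.map_commutator, Subgroup.map_subgroupOf_eq_of_le hFH]
    rw [himage]
    exact hc
  exact hcomm (hFF.trans hFM)

theorem mainTheorem6 (G : Type u) [Group G] [TopologicalSpace G] [IsTopologicalGroup G]
    [CompactSpace G] [TotallyDisconnectedSpace G]
    (hG : IsJustInfinite G) (hnil : IsVirtuallyPronilpotent G) (hab : ¬ IsTopVirtuallyAbelian G) :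
    IsHereditarilyJustInfinite G ↔ IsJustInfinite (topFrattini G) := by
  refine ⟨fun h => ?_, hG.isHereditarilyJustInfinite hab⟩
  obtain ⟨H, hHcl, hHfi, hP⟩ := hnil
  have hF := Subgroup.normalCore_isClosed H hHcl
  have hle := commutator_le_topFrattini hHcl hP hF H.normalCore_le
  have hΦ : topFrattini G ≠ ⊥ := fun hbot => hab ⟨H.normalCore, hF, inferInstance,
    (Subgroup.commutator_self_eq_bot_iff).mp (le_bot_iff.mp (hbot ▸ hle))⟩
  exact h _ (isClosed_topFrattini G)
    (hG.finiteIndex _ (isClosed_topFrattini G) inferInstance hΦ)
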